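/- An additive paired comparison matrix on $n$ items is a real skew-symmetric $n\times n$ matrix $A$; a multiplicative one is a matrix $X$ with $X_{ij}>0$ and $X_{ij}=1/X_{ji}$. For a base $b>1$ the two kinds correspond to each other through $X_{ij}=b^{A_{ij}}$. Consider the following three ranking methods. (a) Principal Eigenvector: the score vector is the positive eigenvector $v$ of $X$ for its eigenvalue of largest modulus (unique up to a positive scalar). (b) HodgeRank: the score vector of $A$ is the vector $h\in\mathbb{R}^n$ (unique up to an additive constant) for which the matrix $(h_i-h_j)_{ij}$ is the $L_2$-projection of $A$ onto the space of strongly transitive matrices, i.e. of matrices $S$ with $S_{ik}=S_{ij}+S_{jk}$ for all $i,j,k$. The score vector of $X$ is the entrywise exponential of a HodgeRank vector of the matrix $(\log X_{ij})_{ij}$ (unique up to a positive scalar). (c) Tropical Eigenvector: the score vector of $A$ is a vector $m\in\mathbb{R}^n$ such that, for some $\lambda\in\mathbb{R}$, $\max_j(A_{ij}+m_j)=\lambda+m_i$ for all $i$; the score vector of $X$ is a positive vector $w$ such that, for some $\lambda\in\mathbb{R}$, $\max_j X_{ij}w_j=\lambda w_i$ for all $i$. A ranking of the items is a permutation $\sigma$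 of $\{1,\dots,n\}$. A method applied to a matrix gives the ranking $\sigma$ if its score vector $s$ for that matrix is unique (up to an additive constant, respectively a positive scalar) and satisfies $s_{\sigma(1)}>s_{\sigma(2)}>\dots>s_{\sigma(n)}$. Theorem. Let $n\ge 4$ and $b>1$. For any two different methods among these three and any rankings $\sigma_1,\sigma_2$ of the $n$ items (which may be equal), there is an additive paired comparison matrix $A$ such that the first method gives the ranking $\sigma_1$ and the second method gives the ranking $\sigma_2$, both when HodgeRank and Tropical Eigenvector are applied to $A$ and when they are applied to the corresponding multiplicative paired comparison matrix $X=(b^{A_{ij}})_{ij}$; Principal Eigenvector is applied to $X$ in either case. -/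

import Mathlib

/-- Additive paired comparison matrix: a real skew-symmetric matrix. -/
def IsAPCM {n : ℕ} (A : Matrix (Fin n) (Fin n) ℝ) : Prop :=
  ∀ i j, A i j = -A j i

/-- Multiplicative paired comparison matrix: positive and symmetrically reciprocal. -/
def IsMPCM {n : ℕ} (X : Matrix (Fin n) (Fin n) ℝ) : Prop :=
  ∀ i j, 0 < X i j ∧ X i j = 1 / X j i

/-- The multiplicative matrix with entries `b ^ A i j` that corresponds to `A` in base `b`. -/
noncomputable def expBase {n : ℕ} (b : ℝ) (A : Matrix (Fin n) (Fin n) ℝ) :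
    Matrix (Fin n) (Fin n) ℝ :=
  Matrix.of fun i j => b ^ A i j

/-- The entrywise natural logarithm. -/
noncomputable def logMatrix {n : ℕ} (X : Matrix (Fin n) (Fin n) ℝ) :
    Matrix (Fin n) (Fin n) ℝ :=
  Matrix.of fun i j => Real.log (X i j)

/-- Strong transitivity (additive scale). -/
def IsStronglyTransitive {n : ℕ} (S : Matrix (Fin n) (Fin n) ℝ) : Prop :=
  ∀ i j k, S i k = S i j + S j k

/-- The matrix of differences `a i - a j` of a score vector `a`. -/
def scoreMatrix {n : ℕ} (a : Fin n → ℝ) : Matrix (Fin n) (Fin n) ℝ :=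
  Matrix.of fun i j => a i - a j

/-- The `L₂`-norm of a matrix. -/
noncomputable def matrixL2Norm {n : ℕ} (A : Matrix (Fin n) (Fin n) ℝ) : ℝ :=
  Real.sqrt (∑ i, ∑ j, A i j ^ 2)

/-- `h` is a HodgeRank vector of `A`: its matrix of differences is a point of the space of
strongly transitive matrices at least `L₂`-distance from `A`. -/
def IsHodgeRankVector {n : ℕ} (A : Matrix (Fin n) (Fin n) ℝ) (h : Fin n → ℝ) : Prop :=
  ∀ S : Matrix (Fin n) (Fin n) ℝ, IsStronglyTransitive S →
    matrixL2Norm (A - scoreMatrix h) ≤ matrixL2Norm (A - S)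

/-- `m` is a max-plus eigenvector of `A`: for some eigenvalue `lam`,
`max_j (A i j + m j) = lam + m i` for every `i`. -/
def IsMaxPlusEigenvector {n : ℕ} (A : Matrix (Fin n) (Fin n) ℝ) (m : Fin n → ℝ) : Prop :=
  ∃ lam : ℝ, ∀ i, IsGreatest (Set.range fun j => A i j + m j) (lam + m i)

/-- `w` is a (positive) max-times eigenvector of `X`: for some eigenvalue `lam`,
`max_j (X i j * w j) = lam * w i` for every `i`. -/
def IsMaxTimesEigenvector {n : ℕ} (X : Matrix (Fin n) (Fin n) ℝ) (w : Fin n → ℝ) : Prop :=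
  (∀ i, 0 < w i) ∧ ∃ lam : ℝ, ∀ i, IsGreatest (Set.range fun j => X i j * w j) (lam * w i)

/-- `v` is a principal (Perron) eigenvector of `X`, taken with positive entries: its eigenvalue
`rho` has the largest modulus among all complex eigenvalues of `X`. -/
def IsPrincipalEigenvector {n : ℕ} (X : Matrix (Fin n) (Fin n) ℝ) (v : Fin n → ℝ) : Prop :=
  (∀ i, 0 < v i) ∧ ∃ rho : ℝ, X.mulVec v = rho • v ∧
    ∀ z ∈ spectrum ℂ (X.map (algebraMap ℝ ℂ)), ‖z‖ ≤ rho

/-- The three ranking methods. -/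
inductive RankingMethod where
  | principalEigenvector
  | hodgeRank
  | tropicalEigenvector

/-- `w` is a score vector that the method finds for the additive matrix `A`. The Principal
Eigenvector method works on the corresponding multiplicative matrix in base `b`. -/
def RankingMethod.IsScore {n : ℕ} (b : ℝ) (M : RankingMethod)
    (A : Matrix (Fin n) (Fin n) ℝ) (w : Fin n → ℝ) : Prop :=
  match M with
  | .principalEigenvector => IsPrincipalEigenvector (expBase b A) w
  | .hodgeRank => IsHodgeRankVector A w
  | .tropicalEigenvector => IsMaxPlusEigenvector A w

/-- `w` is a score vector that the method finds for the multiplicative matrix `X`. -/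
def RankingMethod.IsMulScore {n : ℕ} (M : RankingMethod)
    (X : Matrix (Fin n) (Fin n) ℝ) (w : Fin n → ℝ) : Prop :=
  match M with
  | .principalEigenvector => IsPrincipalEigenvector X w
  | .hodgeRank =>
      (∀ i, 0 < w i) ∧ IsHodgeRankVector (logMatrix X) (fun i => Real.log (w i))
  | .tropicalEigenvector => IsMaxTimesEigenvector X w

/-- Equality up to an additive constant. -/
def EqUpToShift {n : ℕ} (w w' : Fin n → ℝ) : Prop :=
  ∃ c : ℝ, ∀ i, w' i = c + w i

/-- Equality up to a positive scalar. -/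
def EqUpToScale {n : ℕ} (w w' : Fin n → ℝ) : Prop :=
  ∃ c : ℝ, 0 < c ∧ ∀ i, w' i = c * w i

/-- The normalization freedom of the score vectors of an additive matrix. -/
def RankingMethod.SameScore {n : ℕ} (M : RankingMethod) (w w' : Fin n → ℝ) : Prop :=
  match M with
  | .principalEigenvector => EqUpToScale w w'
  | .hodgeRank => EqUpToShift w w'
  | .tropicalEigenvector => EqUpToShift w w'

/-- `w` has no ties and orders the items as `σ 0, σ 1, σ 2, …` from the highest score to the
lowest; so `σ k` is the item in position `k` of the ranking. -/
def InducesRanking {n : ℕ} (w : Fin n → ℝ) (σ : Equiv.Perm (Fin n)) : Prop :=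
  StrictAnti fun k => w (σ k)

/-- Applied to the additive matrix `A`, the method has a score vector, unique up to
normalization, and this vector induces the ranking `σ`. -/
def RankingMethod.Gives {n : ℕ} (b : ℝ) (M : RankingMethod)
    (A : Matrix (Fin n) (Fin n) ℝ) (σ : Equiv.Perm (Fin n)) : Prop :=
  ∃ w : Fin n → ℝ, M.IsScore b A w ∧ (∀ w', M.IsScore b A w' → M.SameScore w w') ∧
    InducesRanking w σ

/-- Applied to the multiplicative matrix `X`, the method has a score vector, unique up to a
positive scalar, and this vector induces the ranking `σ`. -/
def RankingMethod.MulGives {n : ℕ} (M : RankingMethod)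
    (X : Matrix (Fin n) (Fin n) ℝ) (σ : Equiv.Perm (Fin n)) : Prop :=
  ∃ w : Fin n → ℝ, M.IsMulScore X w ∧ (∀ w', M.IsMulScore X w' → EqUpToScale w w') ∧
    InducesRanking w σ

/-!
All three methods are equivariant: adding the matrix of differences `u i - u j` to an additive
matrix adds `u` to its score vector, where for Principal Eigenvector the score vector is measured on
the logarithmic scale. Hence only the differences between the score vectors of two methods matter.
If `x` and `y` are the score vectors of the first and the second method for some matrix, and
`x - y` has no ties, then relabel the items so that `x - y` induces the ranking `σ₁`, and shift by
`-y + ε • z`, where `z` induces `σ₂`. The score vectors become `x - y + ε • z` and `ε • z`, which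
for small `ε > 0` induce `σ₁` and `σ₂`. Since a single shift serves the additive and the
multiplicative scale, this is independent of the base.

It remains to find, for each number `n ≥ 4` of items, a matrix for which the differences between the
score vectors have no ties. One matrix serves all three pairs of methods (`IsOpposed`): a reciprocal
matrix `Y` with constant row sums `rho`, so that Principal Eigenvector ties all items, whose row
products decrease and whose tropical eigenvector increases. For `n = 4` it is explicit
(`exists_isOpposed_four`). In the inductive step (`IsOpposed.exists_succ`) the new item is compared
in the same way, by `c < 1`, with all old ones, where `c ^ 2 + (rho - 1) * c = n` keeps the row
sums constant. By concavity of the logarithm the new item then has the greatest row product, and an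
inequality that is inherited by the larger matrix gives it the lowest tropical score.

The uniqueness of the score vectors is elementary: for Principal Eigenvector by comparing two
positive eigenvectors at their extreme ratios, for HodgeRank by Pythagoras, and for Tropical
Eigenvector because the critical graph of the matrix has a single cycle, which every item reaches.
-/


/-! ### Matrices on which the three methods disagree -/

/-- A reciprocal matrix `Y` on `n + 1` items for which the Principal Eigenvector method ties all
items (`row_sum`), HodgeRank ranks them in the order of their indices (`anti`), and Tropical
Eigenvector ranks them in the reverse order (`mono`). Here `w` is the tropical eigenvector for the
eigenvalue `L`; the maximum in row `i` is attained at `f i` only, and all orbits of `f` reach the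
last item, which makes `w` unique. The bounds on `rho` and on `q = w last / (L * w 0)` are what
allows a further item to be put in front: the comparison `c` of the old items with the new one is
the positive root of `c ^ 2 + (rho - 1) * c = n + 1`, so `n + 1 < rho` gives `c < 1`, and `q_lt`
gives `q < c`. -/
structure IsOpposed {n : ℕ} (Y : Matrix (Fin (n + 1)) (Fin (n + 1)) ℝ) (rho L q : ℝ)
    (w : Fin (n + 1) → ℝ) (f : Fin (n + 1) → Fin (n + 1)) : Prop where
  pos : ∀ i j, 0 < Y i j
  recip : ∀ i j, Y i j * Y j i = 1
  row_sum : ∀ i, ∑ j, Y i j = rho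
  lt_rho : (n + 1 : ℝ) < rho
  anti : StrictAnti fun i => ∑ j, Real.log (Y i j)
  w_pos : ∀ i, 0 < w i
  L_pos : 0 < L
  mono : StrictMono w
  tight : ∀ i, Y i (f i) * w (f i) = L * w i
  slack : ∀ i j, j ≠ f i → Y i j * w j < L * w i
  reach : ∀ i, ∃ k, f^[k] i = Fin.last n
  last_eq : w (Fin.last n) = q * (L * w 0)
  q_lt : q ^ 2 + (rho - 1) * q < n + 1

/-- The base case. The matrix is a rational point of the variety of reciprocal `4 × 4` matrices with
constant row sums. Its critical cycle is `3 → 2 → 1 → 3`, with product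
`3 * (166 / 57) * (11 / 4) = 913 / 38`. -/
theorem exists_isOpposed_four :
    ∃ (Y : Matrix (Fin (3 + 1)) (Fin (3 + 1)) ℝ) (rho L q : ℝ) (w : Fin (3 + 1) → ℝ)
      (f : Fin (3 + 1) → Fin (3 + 1)), IsOpposed Y rho L q w f := by
  obtain ⟨L, hL0, hL3⟩ : ∃ L : ℝ, 0 < L ∧ L ^ 3 = 913 / 38 :=
    ⟨(913 / 38 : ℝ) ^ ((1 : ℝ) / 3), by positivity, by
      rw [← Real.rpow_natCast, ← Real.rpow_mul (by norm_num)]; norm_num⟩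
  have hlo : (28855 / 10000 : ℝ) < L := by
    refine lt_of_pow_lt_pow_left₀ 3 hL0.le ?_
    rw [hL3]; norm_num
  have hhi : L < (28856 / 10000 : ℝ) := by
    refine lt_of_pow_lt_pow_left₀ 3 (by norm_num) ?_
    rw [hL3]; norm_num
  have hi0 : L⁻¹ * L = 1 := inv_mul_cancel₀ hL0.ne'
  have hilo : (34654 / 100000 : ℝ) < L⁻¹ := by
    rw [lt_inv_comm₀ (by norm_num) hL0]; exact hhi.trans (by norm_num)
  have hihi : L⁻¹ < (34657 / 100000 : ℝ) := by
    rw [inv_lt_comm₀ hL0 (by norm_num)]; exact lt_of_le_of_lt (by norm_num) hlo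
  have h2lo : (28855 / 10000 : ℝ) ^ 2 < L ^ 2 := by gcongr
  have h2hi : L ^ 2 < (28856 / 10000 : ℝ) ^ 2 := by gcongr
  have hL32 : L * L ^ 2 = 913 / 38 := by rw [← hL3]; ring
  refine ⟨!![1, 332 / 301, 57 / 43, 11 / 7; 301 / 332, 1, 57 / 166, 11 / 4;
    43 / 57, 166 / 57, 1, 1 / 3; 7 / 11, 4 / 11, 3, 1], 5, L, 7 / 11,
    ![11 / 7 * L⁻¹, 19 / 166 * L ^ 2, 1 / 3 * L, 1], ![3, 3, 1, 2], ?_⟩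
  constructor
  · intro i j; fin_cases i <;> fin_cases j <;> norm_num
  · intro i j; fin_cases i <;> fin_cases j <;> norm_num
  · intro i; fin_cases i <;> simp [Fin.sum_univ_four] <;> norm_num
  · norm_num
  · have key : ∀ x₁ x₂ x₃ x₄ y₁ y₂ y₃ y₄ : ℝ, 0 < x₁ → 0 < x₂ → 0 < x₃ → 0 < x₄ → 0 < y₁ →
        0 < y₂ → 0 < y₃ → 0 < y₄ → x₁ * x₂ * x₃ * x₄ < y₁ * y₂ * y₃ * y₄ →
        Real.log x₁ + Real.log x₂ + Real.log x₃ + Real.log x₄ <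
          Real.log y₁ + Real.log y₂ + Real.log y₃ + Real.log y₄ := by
      intro x₁ x₂ x₃ x₄ y₁ y₂ y₃ y₄ h1 h2 h3 h4 k1 k2 k3 k4 h
      rw [← Real.log_mul, ← Real.log_mul, ← Real.log_mul, ← Real.log_mul, ← Real.log_mul,
        ← Real.log_mul]
      · exact Real.log_lt_log (by positivity) h
      all_goals positivity
    refine Fin.strictAnti_iff_succ_lt.2 fun i => ?_
    refine lt_of_eq_of_lt (Fin.sum_univ_four _) (lt_of_lt_of_eq ?_ (Fin.sum_univ_four _).symm)
    fin_cases i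
    · refine key (301 / 332) 1 (57 / 166) (11 / 4) 1 (332 / 301) (57 / 43) (11 / 7)
        ?_ ?_ ?_ ?_ ?_ ?_ ?_ ?_ ?_ <;> norm_num
    · refine key (43 / 57) (166 / 57) 1 (1 / 3) (301 / 332) 1 (57 / 166) (11 / 4)
        ?_ ?_ ?_ ?_ ?_ ?_ ?_ ?_ ?_ <;> norm_num
    · refine key (7 / 11) (4 / 11) 3 1 (43 / 57) (166 / 57) 1 (1 / 3)
        ?_ ?_ ?_ ?_ ?_ ?_ ?_ ?_ ?_ <;> norm_num
  · intro i; fin_cases i <;> simp <;> positivity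
  · exact hL0
  · rw [Fin.strictMono_iff_lt_succ]
    intro i; fin_cases i <;> simp <;> linarith
  · intro i; fin_cases i <;> simp <;> nlinarith
  · intro i j; fin_cases i <;> fin_cases j <;> simp <;> nlinarith
  · intro i
    fin_cases i
    · exact ⟨1, rfl⟩
    · exact ⟨1, rfl⟩
    · exact ⟨2, rfl⟩
    · exact ⟨0, rfl⟩
  · simp [Fin.last]; field_simp
  · norm_num

/-- By concavity of the logarithm, a row with sum `rho` has log-sum at most `N * log (rho / N)`. -/
theorem sum_log_le {ι : Type*} [Fintype ι] [Nonempty ι] (y : ι → ℝ) (hy : ∀ j, 0 < y j) :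
    ∑ j, Real.log (y j) ≤ Fintype.card ι * Real.log ((∑ j, y j) / Fintype.card ι) := by
  have hN : (0 : ℝ) < Fintype.card ι := by exact_mod_cast Fintype.card_pos
  have hs : 0 < ∑ j, y j := Finset.sum_pos (fun j _ => hy j) Finset.univ_nonempty
  set t := (∑ j, y j) / Fintype.card ι with ht
  have ht0 : 0 < t := by positivity
  have h : ∀ j, Real.log (y j) ≤ Real.log t + (y j / t - 1) := by
    intro j
    have := Real.log_le_sub_one_of_pos (div_pos (hy j) ht0)
    rw [Real.log_div (hy j).ne' ht0.ne'] at this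
    linarith
  calc ∑ j, Real.log (y j) ≤ ∑ j, (Real.log t + (y j / t - 1)) := Finset.sum_le_sum fun j _ => h j
    _ = Fintype.card ι * Real.log t := by
      rw [Finset.sum_add_distrib, Finset.sum_sub_distrib, ← Finset.sum_div]
      simp only [Finset.sum_const, Finset.card_univ, nsmul_eq_mul, mul_one]
      have : (∑ j, y j) / t = Fintype.card ι := by rw [ht]; field_simp
      rw [this]; ring

/-- The inductive step: a new item, put in front, compares in the same way with all old items,
with `Y i new = c`; the equation for `c` says that the row sums stay constant. The new item comes
first for HodgeRank and last for Tropical Eigenvector, since `q < c < 1`. -/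
theorem IsOpposed.exists_succ {n : ℕ} {Y : Matrix (Fin (n + 1)) (Fin (n + 1)) ℝ} {rho L q : ℝ}
    {w : Fin (n + 1) → ℝ} {f : Fin (n + 1) → Fin (n + 1)} (h : IsOpposed Y rho L q w f) :
    ∃ (Y' : Matrix (Fin (n + 1 + 1)) (Fin (n + 1 + 1)) ℝ) (rho' L' q' : ℝ)
      (w' : Fin (n + 1 + 1) → ℝ) (f' : Fin (n + 1 + 1) → Fin (n + 1 + 1)),
      IsOpposed Y' rho' L' q' w' f' := by
  have hN : (0 : ℝ) < n + 1 := by positivity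
  have hrho := h.lt_rho
  have hL := h.L_pos
  have hn0 : (0 : ℝ) ≤ n := by positivity
  obtain ⟨c, hc0, hc⟩ : ∃ c : ℝ, 0 < c ∧ c ^ 2 + (rho - 1) * c = n + 1 := by
    have hs : √((rho - 1) ^ 2 + 4 * (n + 1)) ^ 2 = (rho - 1) ^ 2 + 4 * (n + 1) :=
      Real.sq_sqrt (by positivity)
    refine ⟨(√((rho - 1) ^ 2 + 4 * (n + 1)) - (rho - 1)) / 2, ?_, by linear_combination hs / 4⟩
    have : rho - 1 < √((rho - 1) ^ 2 + 4 * (n + 1)) := Real.lt_sqrt_of_sq_lt (by linarith)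
    linarith
  have hc1 : c < 1 := by
    by_contra! hge
    nlinarith [mul_le_mul_of_nonneg_left hge (by linarith : 0 ≤ rho - 1)]
  have hqc : q < c := by
    by_contra! hle
    nlinarith [mul_le_mul_of_nonneg_left hle (by linarith : 0 ≤ rho - 1), h.q_lt]
  set wl := w (Fin.last n) with hwl
  have hwl0 : 0 < wl := h.w_pos _
  have hw0 : 0 < w 0 := h.w_pos 0
  have hwle : ∀ i, w i ≤ wl := fun i => h.mono.monotone (Fin.le_last i)
  have h0le : ∀ i, w 0 ≤ w i := fun i => h.mono.monotone (Fin.zero_le i)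
  have hlc : wl < c * (L * w 0) := by
    have hl : wl = q * (L * w 0) := h.last_eq
    rw [hl]; exact mul_lt_mul_of_pos_right hqc (by positivity)
  have hlL : wl < L * w 0 := hlc.trans_le (mul_le_of_le_one_left (by positivity) hc1.le)
  have hL1 : 1 < L := by
    by_contra! hle
    nlinarith [hwle 0]
  -- Every row of `Y` has a smaller log-sum in the new matrix than the row of the new item.
  have hnew : ∀ i, ∑ j, Real.log (Y i j) + Real.log c < -((n + 1) * Real.log c) := by
    intro i
    have h1 := sum_log_le (Y i) (h.pos i)
    rw [h.row_sum i, Fintype.card_fin] at h1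
    push_cast at h1
    -- Solve the equation for `c` for `rho`; the second factor is close to `1`.
    have hr : rho / (n + 1) = c⁻¹ * (1 + c * (1 - c) / (n + 1)) := by
      field_simp; linear_combination hc
    have hpos : 0 < c * (1 - c) / (n + 1) := by
      have : 0 < 1 - c := by linarith
      positivity
    rw [hr, Real.log_mul (by positivity) (by positivity), Real.log_inv] at h1
    have h2 := Real.log_le_sub_one_of_pos (by positivity : 0 < 1 + c * (1 - c) / (n + 1))
    have h3 := Real.log_le_sub_one_of_pos hc0
    have h4 : (n + 1) * Real.log (1 + c * (1 - c) / (n + 1)) ≤ c * (1 - c) :=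
      (mul_le_mul_of_nonneg_left h2 hN.le).trans (by field_simp; linarith)
    nlinarith
  refine ⟨Matrix.of (Fin.cons (Fin.cons 1 fun _ => c⁻¹) fun i => Fin.cons c (Y i)), rho + c, L, c,
    Fin.cons (wl / (c * L)) w, Fin.cons (Fin.last n).succ fun i => (f i).succ, ?_⟩
  constructor
  · intro i j
    refine Fin.cases ?_ (fun i => ?_) i <;> refine Fin.cases ?_ (fun j => ?_) j <;> simp
    · exact hc0
    · exact hc0
    · exact h.pos i j
  · intro i j
    refine Fin.cases ?_ (fun i => ?_) i <;> refine Fin.cases ?_ (fun j => ?_) j <;>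
      simp [hc0.ne', h.recip]
  · intro i
    refine Fin.cases ?_ (fun i => ?_) i
    · simp [Fin.sum_univ_succ (n := n + 1)]
      field_simp
      linear_combination -hc
    · simp [Fin.sum_univ_succ (n := n + 1), h.row_sum, add_comm]
  · push_cast
    by_contra! hle
    nlinarith
  · intro i j
    refine Fin.cases ?_ (fun i => ?_) i <;> refine Fin.cases ?_ (fun j => ?_) j
    · simp
    · intro _
      simp only [Matrix.of_apply, Fin.sum_univ_succ (n := n + 1), Fin.cons_zero, Fin.cons_succ,
        Real.log_one, Real.log_inv, Finset.sum_const, Finset.card_univ, Fintype.card_fin,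
        nsmul_eq_mul]
      push_cast
      linarith [hnew j]
    · simp
    · intro hij
      simpa [Fin.sum_univ_succ (n := n + 1)] using h.anti (Fin.succ_lt_succ_iff.1 hij)
  · intro i
    refine Fin.cases ?_ (fun i => ?_) i
    · simp only [Fin.cons_zero]; positivity
    · simpa using h.w_pos i
  · exact hL
  · have hnew_lt : wl / (c * L) < w 0 := by
      rw [div_lt_iff₀ (by positivity)]; linarith
    intro i j
    refine Fin.cases ?_ (fun i => ?_) i <;> refine Fin.cases ?_ (fun j => ?_) j
    · simp
    · intro _; simpa using hnew_lt.trans_le (h0le j)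
    · simp
    · intro hij; simpa using h.mono (Fin.succ_lt_succ_iff.1 hij)
  · intro i
    refine Fin.cases ?_ (fun i => ?_) i
    · simp only [Matrix.of_apply, Fin.cons_zero, Fin.cons_succ, ← hwl]; field_simp
    · simpa using h.tight i
  · intro i j
    refine Fin.cases ?_ (fun i => ?_) i <;> refine Fin.cases ?_ (fun j => ?_) j
    · intro _
      simp only [Matrix.of_apply, Fin.cons_zero]
      exact mul_lt_mul_of_pos_right hL1 (by positivity)
    · intro hj
      have hj' : j ≠ Fin.last n := fun e => hj (by simp [e])
      have := h.mono (Fin.lt_last_iff_ne_last.2 hj')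
      simp only [Matrix.of_apply, Fin.cons_zero, Fin.cons_succ]
      calc c⁻¹ * w j < c⁻¹ * wl := mul_lt_mul_of_pos_left this (by positivity)
        _ = L * (wl / (c * L)) := by field_simp
    · intro _
      simp only [Matrix.of_apply, Fin.cons_zero, Fin.cons_succ]
      calc c * (wl / (c * L)) = wl / L := by field_simp
        _ < wl := div_lt_self hwl0 hL1
        _ < L * w 0 := hlL
        _ ≤ L * w i := mul_le_mul_of_nonneg_left (h0le i) hL.le
    · intro hj
      simpa using h.slack i j fun e => hj (by simp [e])
  · have hsemi : Function.Semiconj Fin.succ f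
        (Fin.cons (Fin.last n).succ fun i => (f i).succ : Fin (n + 1 + 1) → Fin (n + 1 + 1)) :=
      fun i => by simp
    have hs : ∀ i : Fin (n + 1), ∃ k, (Fin.cons (Fin.last n).succ fun i => (f i).succ :
        Fin (n + 1 + 1) → Fin (n + 1 + 1))^[k] i.succ = Fin.last (n + 1) := by
      intro i
      obtain ⟨k, hk⟩ := h.reach i
      exact ⟨k, by rw [← (hsemi.iterate_right k).eq, hk, Fin.succ_last]⟩
    intro i
    refine Fin.cases ?_ hs i
    exact ⟨1, by simp⟩
  · rw [← Fin.succ_last]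
    simp only [Fin.cons_succ, Fin.cons_zero, ← hwl]; field_simp
  · push_cast
    nlinarith

theorem exists_isOpposed (k : ℕ) :
    ∃ (Y : Matrix (Fin (k + 3 + 1)) (Fin (k + 3 + 1)) ℝ) (rho L q : ℝ)
      (w : Fin (k + 3 + 1) → ℝ) (f : Fin (k + 3 + 1) → Fin (k + 3 + 1)),
      IsOpposed Y rho L q w f := by
  induction k with
  | zero => exact exists_isOpposed_four
  | succ k ih =>
    obtain ⟨Y, rho, L, q, w, f, h⟩ := ih
    rw [Nat.add_right_comm k 1 3]
    exact h.exists_succ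

/-! ### Matrices with constant score vectors -/

/-- The logarithmic score vector of the skew-symmetric matrix `D` under the method `M` is unique
and constant, in terms of the entries of `D`. For Tropical Eigenvector: the maximum of row `i` is
the same number `lam` for all `i`, it is attained at `f i` only, and all orbits of `f` meet in one
item, so that the critical graph has a single cycle. -/
def RankingMethod.Balanced {n : ℕ} (b : ℝ) (M : RankingMethod)
    (D : Matrix (Fin n) (Fin n) ℝ) : Prop :=
  match M with
  | .principalEigenvector => ∃ rho : ℝ, ∀ i, ∑ j, b ^ D i j = rho
  | .hodgeRank => ∀ i, ∑ j, D i j = 0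
  | .tropicalEigenvector => ∃ (lam : ℝ) (f : Fin n → Fin n) (r : Fin n),
      (∀ i, D i (f i) = lam) ∧ (∀ i j, j ≠ f i → D i j < lam) ∧ ∀ i, ∃ k, f^[k] i = r

theorem scoreMatrix_add {n : ℕ} (u v : Fin n → ℝ) :
    scoreMatrix (u + v) = scoreMatrix u + scoreMatrix v := by
  ext i j; simp [scoreMatrix]; ring

theorem RankingMethod.Balanced.submatrix {n : ℕ} {b : ℝ} {M : RankingMethod}
    {D : Matrix (Fin n) (Fin n) ℝ} (h : M.Balanced b D) (τ : Equiv.Perm (Fin n)) :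
    M.Balanced b (D.submatrix τ τ) := by
  cases M with
  | principalEigenvector =>
    obtain ⟨rho, h⟩ := h
    exact ⟨rho, fun i => (Equiv.sum_comp τ fun j => b ^ D (τ i) j).trans (h (τ i))⟩
  | hodgeRank => exact fun i => (Equiv.sum_comp τ fun j => D (τ i) j).trans (h (τ i))
  | tropicalEigenvector =>
    obtain ⟨lam, f, r, h1, h2, h3⟩ := h
    have hsemi : Function.Semiconj τ.symm f fun i => τ.symm (f (τ i)) := fun i => by simp
    refine ⟨lam, fun i => τ.symm (f (τ i)), τ.symm r, fun i => by simp [h1], fun i j hj => ?_,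
      fun i => ?_⟩
    · exact h2 _ _ fun e => hj (by simp [← e])
    · obtain ⟨k, hk⟩ := h3 (τ i)
      exact ⟨k, by rw [← hk, (hsemi.iterate_right k).eq, Equiv.symm_apply_apply]⟩

/-! ### Principal eigenvectors -/

/-- A matrix of positive entries has, up to a scalar, no positive eigenvector besides a given one;
existence is not needed, so this elementary part of Perron's theorem suffices. -/
theorem eqUpToScale_of_mulVec_eq_smul {n : ℕ} {X : Matrix (Fin n) (Fin n) ℝ}
    (hX : ∀ i j, 0 < X i j) {v v' : Fin n → ℝ} (hv : ∀ i, 0 < v i) (hv' : ∀ i, 0 < v' i)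
    {rho rho' : ℝ} (h : X.mulVec v = rho • v) (h' : X.mulVec v' = rho' • v') :
    EqUpToScale v v' := by
  have e : ∀ i, ∑ j, X i j * v j = rho * v i := fun i => congrFun h i
  have e' : ∀ i, ∑ j, X i j * v' j = rho' * v' i := fun i => congrFun h' i
  rcases isEmpty_or_nonempty (Fin n) with hn | hn
  · exact ⟨1, one_pos, fun i => isEmptyElim i⟩
  obtain ⟨p, hp⟩ := Finite.exists_min fun i => v' i / v i
  obtain ⟨q, hq⟩ := Finite.exists_max fun i => v' i / v i
  set s := v' p / v p with hs
  set t := v' q / v q with ht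
  have hsle : ∀ j, s * v j ≤ v' j := fun j => (le_div_iff₀ (hv j)).1 (hp j)
  have hlet : ∀ j, v' j ≤ t * v j := fun j => (div_le_iff₀ (hv j)).1 (hq j)
  have hsp : s * v p = v' p := div_mul_cancel₀ _ (hv p).ne'
  have htq : t * v q = v' q := div_mul_cancel₀ _ (hv q).ne'
  have hs0 : 0 < s := div_pos (hv' p) (hv p)
  have h1 : rho ≤ rho' := by
    have : s * (rho * v p) ≤ rho' * v' p := by
      rw [← e, ← e', Finset.mul_sum]
      refine Finset.sum_le_sum fun j _ => ?_
      calc s * (X p j * v j) = X p j * (s * v j) := by ring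
        _ ≤ _ := mul_le_mul_of_nonneg_left (hsle j) (hX p j).le
    refine le_of_mul_le_mul_right ?_ (hv' p)
    rw [← hsp] at this ⊢
    linarith
  have h2 : rho' ≤ rho := by
    have : rho' * v' q ≤ t * (rho * v q) := by
      rw [← e, ← e', Finset.mul_sum]
      refine Finset.sum_le_sum fun j _ => ?_
      calc X q j * v' j ≤ X q j * (t * v j) := mul_le_mul_of_nonneg_left (hlet j) (hX q j).le
        _ = _ := by ring
    refine le_of_mul_le_mul_right ?_ (hv' q)
    rw [← htq] at this ⊢
    linarith
  have hrr : rho = rho' := le_antisymm h1 h2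
  have hz : ∑ j, X p j * (v' j - s * v j) = 0 := by
    have : ∑ j, X p j * (v' j - s * v j) = ∑ j, X p j * v' j - s * ∑ j, X p j * v j := by
      rw [Finset.mul_sum, ← Finset.sum_sub_distrib]
      exact Finset.sum_congr rfl fun j _ => by ring
    rw [this, e, e', ← hsp, hrr]; ring
  rw [Finset.sum_eq_zero_iff_of_nonneg
    fun j _ => mul_nonneg (hX p j).le (sub_nonneg.2 (hsle j))] at hz
  refine ⟨s, hs0, fun j => ?_⟩
  have := (mul_eq_zero.1 (hz j (Finset.mem_univ j))).resolve_left (hX p j).ne'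
  linarith

/-- The eigenvalue of a positive eigenvector of a matrix of positive entries bounds the modulus of
all eigenvalues. -/
theorem isPrincipalEigenvector_of_mulVec_eq_smul {n : ℕ} {X : Matrix (Fin n) (Fin n) ℝ}
    (hX : ∀ i j, 0 < X i j) {v : Fin n → ℝ} (hv : ∀ i, 0 < v i) {rho : ℝ}
    (h : X.mulVec v = rho • v) : IsPrincipalEigenvector X v := by
  have e : ∀ i, ∑ j, X i j * v j = rho * v i := fun i => congrFun h i
  refine ⟨hv, rho, h, fun z hz => ?_⟩
  rw [← Matrix.spectrum_toLin', ← Module.End.hasEigenvalue_iff_mem_spectrum] at hz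
  obtain ⟨u, hu⟩ := hz.exists_hasEigenvector
  have hu1 := hu.apply_eq_smul
  have eu : ∀ i, ∑ j, (X i j : ℂ) * u j = z * u i := fun i => by
    simpa [Matrix.toLin'_apply, Matrix.mulVec, dotProduct] using congrFun hu1 i
  obtain ⟨i₀, hi₀⟩ := Function.ne_iff.1 hu.2
  have : Nonempty (Fin n) := ⟨i₀⟩
  obtain ⟨p, hp⟩ := Finite.exists_max fun i => ‖u i‖ / v i
  set t := ‖u p‖ / v p with ht
  have hlet : ∀ j, ‖u j‖ ≤ t * v j := fun j => (div_le_iff₀ (hv j)).1 (hp j)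
  have htp : t * v p = ‖u p‖ := div_mul_cancel₀ _ (hv p).ne'
  have ht0 : 0 < t := lt_of_lt_of_le (div_pos (norm_pos_iff.2 hi₀) (hv i₀)) (hp i₀)
  have hup : 0 < ‖u p‖ := htp ▸ mul_pos ht0 (hv p)
  have : ‖z‖ * ‖u p‖ ≤ t * (rho * v p) := by
    rw [← norm_mul, ← eu, ← e, Finset.mul_sum]
    refine (norm_sum_le _ _).trans (Finset.sum_le_sum fun j _ => ?_)
    rw [norm_mul, Complex.norm_real, Real.norm_of_nonneg (hX p j).le]
    calc X p j * ‖u j‖ ≤ X p j * (t * v j) := mul_le_mul_of_nonneg_left (hlet j) (hX p j).le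
      _ = _ := by ring
  refine le_of_mul_le_mul_right ?_ hup
  rw [← htp] at this ⊢
  linarith

/-! ### HodgeRank vectors -/

theorem sum_sq_nonneg {n : ℕ} (A : Matrix (Fin n) (Fin n) ℝ) : 0 ≤ ∑ i, ∑ j, A i j ^ 2 :=
  Finset.sum_nonneg fun _ _ => Finset.sum_nonneg fun _ _ => sq_nonneg _

theorem IsStronglyTransitive.exists_eq_scoreMatrix {n : ℕ} {S : Matrix (Fin n) (Fin n) ℝ}
    (hS : IsStronglyTransitive S) : ∃ a, S = scoreMatrix a := by
  rcases isEmpty_or_nonempty (Fin n) with hn | ⟨⟨k⟩⟩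
  · exact ⟨fun _ => 0, Matrix.ext fun i => isEmptyElim i⟩
  · refine ⟨fun i => S i k, Matrix.ext fun i j => ?_⟩
    have := hS i j k
    simp only [scoreMatrix, Matrix.of_apply]
    linarith

theorem isStronglyTransitive_scoreMatrix {n : ℕ} (a : Fin n → ℝ) :
    IsStronglyTransitive (scoreMatrix a) := fun i j k => by
  simp only [scoreMatrix, Matrix.of_apply]; ring

/-- Pythagoras: if the skew-symmetric matrix `A - scoreMatrix h` has row sums zero, then it is
orthogonal to all matrices of differences. -/
theorem sum_sq_sub_scoreMatrix {n : ℕ} {A : Matrix (Fin n) (Fin n) ℝ} (hA : IsAPCM A)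
    {h : Fin n → ℝ} (hh : ∀ i, ∑ j, (A - scoreMatrix h) i j = 0) (a : Fin n → ℝ) :
    ∑ i, ∑ j, (A - scoreMatrix a) i j ^ 2 =
      ∑ i, ∑ j, (A - scoreMatrix h) i j ^ 2 + ∑ i, ∑ j, scoreMatrix (h - a) i j ^ 2 := by
  set D := A - scoreMatrix h with hD
  have hskew : ∀ i j, D i j = -D j i := fun i j => by
    simp only [hD, scoreMatrix, Matrix.sub_apply, Matrix.of_apply]
    rw [hA i j]; ring
  have hcol : ∀ j, ∑ i, D i j = 0 := fun j => by
    rw [← neg_eq_zero, ← Finset.sum_neg_distrib, ← hh j]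
    exact Finset.sum_congr rfl fun i _ => (hskew j i).symm
  have hort : ∑ i, ∑ j, D i j * scoreMatrix (h - a) i j = 0 := by
    have h1 : ∑ i, ∑ j, D i j * (h - a) i = 0 := by
      simp_rw [← Finset.sum_mul, hh, zero_mul, Finset.sum_const_zero]
    have h2 : ∑ i, ∑ j, D i j * (h - a) j = 0 := by
      rw [Finset.sum_comm]
      simp_rw [← Finset.sum_mul, hcol, zero_mul, Finset.sum_const_zero]
    simp only [scoreMatrix, Matrix.of_apply, mul_sub, Finset.sum_sub_distrib, h1, h2, sub_zero]
  have hexp : ∀ i j, (A - scoreMatrix a) i j ^ 2 =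
      D i j ^ 2 + 2 * (D i j * scoreMatrix (h - a) i j) + scoreMatrix (h - a) i j ^ 2 := by
    intro i j
    simp only [hD, scoreMatrix, Matrix.sub_apply, Matrix.of_apply, Pi.sub_apply]; ring
  simp_rw [hexp, Finset.sum_add_distrib, ← Finset.mul_sum, hort]
  ring

theorem isHodgeRankVector_of_sum_eq_zero {n : ℕ} {A : Matrix (Fin n) (Fin n) ℝ} (hA : IsAPCM A)
    {h : Fin n → ℝ} (hh : ∀ i, ∑ j, (A - scoreMatrix h) i j = 0) : IsHodgeRankVector A h := by
  intro S hS
  obtain ⟨a, rfl⟩ := hS.exists_eq_scoreMatrix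
  refine Real.sqrt_le_sqrt ?_
  rw [sum_sq_sub_scoreMatrix hA hh a]
  exact le_add_of_nonneg_right (sum_sq_nonneg _)

theorem IsHodgeRankVector.eqUpToShift {n : ℕ} {A : Matrix (Fin n) (Fin n) ℝ} (hA : IsAPCM A)
    {h h' : Fin n → ℝ} (hh : ∀ i, ∑ j, (A - scoreMatrix h) i j = 0)
    (hh' : IsHodgeRankVector A h') : EqUpToShift h h' := by
  have hle := hh' _ (isStronglyTransitive_scoreMatrix h)
  rw [matrixL2Norm, matrixL2Norm, Real.sqrt_le_sqrt_iff (sum_sq_nonneg _),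
    sum_sq_sub_scoreMatrix hA hh h'] at hle
  have hz : ∑ i, ∑ j, scoreMatrix (h - h') i j ^ 2 = 0 :=
    le_antisymm (by linarith) (sum_sq_nonneg _)
  rcases isEmpty_or_nonempty (Fin n) with hn | ⟨⟨k⟩⟩
  · exact ⟨0, fun i => isEmptyElim i⟩
  refine ⟨h' k - h k, fun i => ?_⟩
  have hz' := (Finset.sum_eq_zero_iff_of_nonneg fun _ _ =>
    Finset.sum_nonneg fun _ _ => sq_nonneg _).1 hz i (Finset.mem_univ i)
  replace hz' := (Finset.sum_eq_zero_iff_of_nonneg fun _ _ => sq_nonneg _).1 hz'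
  have := pow_eq_zero_iff (two_ne_zero) |>.1 (hz' k (Finset.mem_univ k))
  simp only [scoreMatrix, Matrix.of_apply, Pi.sub_apply] at this
  linarith

/-! ### Tropical eigenvectors -/

theorem IsMaxPlusEigenvector.eqUpToShift {n : ℕ} {A : Matrix (Fin n) (Fin n) ℝ} {m m' : Fin n → ℝ}
    {lam : ℝ} {f : Fin n → Fin n} {r : Fin n}
    (htight : ∀ i, (A - scoreMatrix m) i (f i) = lam)
    (hslack : ∀ i j, j ≠ f i → (A - scoreMatrix m) i j < lam)
    (hreach : ∀ i, ∃ k, f^[k] i = r) (h : IsMaxPlusEigenvector A m') : EqUpToShift m m' := by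
  obtain ⟨lam', h⟩ := h
  simp only [scoreMatrix, Matrix.sub_apply, Matrix.of_apply] at htight hslack
  have : Nonempty (Fin n) := ⟨r⟩
  -- `d` is an eigenvector of the matrix whose row maxima are all `lam`.
  set d : Fin n → ℝ := fun i => m' i - m i with hd
  have hle : ∀ i, lam + d (f i) ≤ lam' + d i := fun i => by
    have := (h i).2 ⟨f i, rfl⟩
    have := htight i
    simp only [hd] at *
    linarith
  have hle' : ∀ i j, A i j - (m i - m j) ≤ lam := fun i j => by
    by_cases hj : j = f i
    · rw [hj, htight]
    · exact (hslack i j hj).le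
  obtain ⟨p, hp⟩ := Finite.exists_min d
  obtain ⟨q, hq⟩ := Finite.exists_max d
  have hlam : lam' = lam := by
    refine le_antisymm ?_ (by linarith [hle p, hp (f p)])
    obtain ⟨j, hj⟩ := (h q).1
    have h1 := hle' q j
    have h2 := hq j
    simp only [hd] at *
    linarith
  subst hlam
  -- `d` does not increase along the orbits of `f`, and stays maximal along the orbit of `q`.
  have hdec : ∀ k i, d (f^[k] i) ≤ d i := by
    intro k
    induction k with
    | zero => exact fun i => le_rfl
    | succ k ih => exact fun i => (ih (f i)).trans (by linarith [hle i])
  have hmax : ∀ k, d (f^[k] q) = d q := by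
    intro k
    induction k with
    | zero => rfl
    | succ k ih =>
      rw [Function.iterate_succ_apply']
      set i := f^[k] q
      obtain ⟨j, hj⟩ := (h i).1
      have h1 := hle' i j
      have h2 := hq j
      have hji : j = f i := by
        by_contra hne
        have h3 := hslack i j hne
        simp only [hd] at *
        linarith
      subst hji
      have h4 := hq (f i)
      simp only [hd] at *
      linarith
  have hr : ∀ i, d r ≤ d i := fun i => by
    obtain ⟨k, hk⟩ := hreach i
    exact hk ▸ hdec k i
  have hrq : d r = d q := by
    obtain ⟨k, hk⟩ := hreach q
    exact hk ▸ hmax k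
  refine ⟨d r, fun i => ?_⟩
  have h1 := hr i
  have h2 := hq i
  rw [← hrq] at h2
  have := le_antisymm h1 h2
  simp only [hd] at *
  linarith

theorem isMaxPlusEigenvector_of_tight {n : ℕ} {A : Matrix (Fin n) (Fin n) ℝ} {m : Fin n → ℝ}
    {lam : ℝ} {f : Fin n → Fin n} (htight : ∀ i, (A - scoreMatrix m) i (f i) = lam)
    (hslack : ∀ i j, j ≠ f i → (A - scoreMatrix m) i j < lam) : IsMaxPlusEigenvector A m := by
  simp only [scoreMatrix, Matrix.sub_apply, Matrix.of_apply] at htight hslack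
  refine ⟨lam, fun i => ⟨⟨f i, by linarith [htight i]⟩, ?_⟩⟩
  rintro _ ⟨j, rfl⟩
  by_cases hj : j = f i
  · subst hj; linarith [htight i]
  · linarith [hslack i j hj]

/-- In base `b`, max-times eigenvectors are the exponentials of max-plus eigenvectors. -/
theorem IsMaxPlusEigenvector.isMaxTimesEigenvector {n : ℕ} {b : ℝ} (hb : 1 < b)
    {A : Matrix (Fin n) (Fin n) ℝ} {m : Fin n → ℝ} (h : IsMaxPlusEigenvector A m) :
    IsMaxTimesEigenvector (expBase b A) fun i => b ^ m i := by
  have hb0 : 0 < b := one_pos.trans hb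
  obtain ⟨lam, h⟩ := h
  refine ⟨fun i => Real.rpow_pos_of_pos hb0 _, b ^ lam, fun i => ⟨?_, ?_⟩⟩
  · obtain ⟨j, hj⟩ := (h i).1
    refine ⟨j, ?_⟩
    simp only [expBase, Matrix.of_apply] at *
    rw [← Real.rpow_add hb0, ← Real.rpow_add hb0, hj]
  · rintro _ ⟨j, rfl⟩
    simp only [expBase, Matrix.of_apply]
    rw [← Real.rpow_add hb0, ← Real.rpow_add hb0]
    exact Real.rpow_le_rpow_of_exponent_le hb.le ((h i).2 ⟨j, rfl⟩)

theorem IsMaxTimesEigenvector.isMaxPlusEigenvector {n : ℕ} {b : ℝ} (hb : 1 < b)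
    {A : Matrix (Fin n) (Fin n) ℝ} {w : Fin n → ℝ} (h : IsMaxTimesEigenvector (expBase b A) w) :
    IsMaxPlusEigenvector A fun i => Real.logb b (w i) := by
  have hb0 : 0 < b := one_pos.trans hb
  obtain ⟨hw, lam, h⟩ := h
  have hmul : ∀ i j, Real.logb b (expBase b A i j * w j) = A i j + Real.logb b (w j) := by
    intro i j
    rw [expBase, Matrix.of_apply, Real.logb_mul (Real.rpow_pos_of_pos hb0 _).ne' (hw j).ne',
      Real.logb_rpow hb0 hb.ne']
  have hpos : ∀ i j, 0 < expBase b A i j * w j := fun i j =>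
    mul_pos (Real.rpow_pos_of_pos hb0 _) (hw j)
  have hlam : ∀ i, 0 < lam * w i := fun i => by
    obtain ⟨j, hj⟩ := (h i).1
    exact hj ▸ hpos i j
  have hmul' : ∀ i, Real.logb b (lam * w i) = Real.logb b lam + Real.logb b (w i) := fun i =>
    Real.logb_mul (fun e => by simpa [e] using hlam i) (hw i).ne'
  refine ⟨Real.logb b lam, fun i => ⟨?_, ?_⟩⟩
  · obtain ⟨j, hj⟩ := (h i).1
    exact ⟨j, by rw [← hmul', ← hj, hmul]⟩
  · rintro _ ⟨j, rfl⟩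
    change A i j + Real.logb b (w j) ≤ Real.logb b lam + Real.logb b (w i)
    rw [← hmul', ← hmul]
    exact (Real.logb_le_logb hb (hpos i j) (hlam i)).2 ((h i).2 ⟨j, rfl⟩)

/-! ### Rankings from balanced matrices -/

theorem EqUpToShift.eqUpToScale_rpow {n : ℕ} {b : ℝ} (hb : 1 < b) {u w : Fin n → ℝ}
    (hw : ∀ i, 0 < w i) (h : EqUpToShift u fun i => Real.logb b (w i)) :
    EqUpToScale (fun i => b ^ u i) w := by
  have hb0 : 0 < b := one_pos.trans hb
  obtain ⟨c, hc⟩ := h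
  refine ⟨b ^ c, Real.rpow_pos_of_pos hb0 _, fun i => ?_⟩
  rw [← Real.rpow_add hb0, ← hc, Real.rpow_logb hb0 hb.ne' (hw i)]

theorem InducesRanking.rpow {n : ℕ} {b : ℝ} (hb : 1 < b) {u : Fin n → ℝ} {σ : Equiv.Perm (Fin n)}
    (h : InducesRanking u σ) : InducesRanking (fun i => b ^ u i) σ :=
  fun _ _ hij => Real.rpow_lt_rpow_of_exponent_lt hb (h hij)

/-- All three methods are equivariant under adding a matrix of differences, so `u` is the unique
additive score vector of `A` (up to a constant) and `b ^ u` is that of `expBase b A`. -/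
theorem RankingMethod.Balanced.gives {n : ℕ} {b : ℝ} (hb : 1 < b) {M : RankingMethod}
    {A : Matrix (Fin n) (Fin n) ℝ} (hA : IsAPCM A) {u : Fin n → ℝ}
    (h : M.Balanced b (A - scoreMatrix u)) {σ : Equiv.Perm (Fin n)} (hσ : InducesRanking u σ) :
    M.Gives b A σ ∧ M.MulGives (expBase b A) σ := by
  have hb0 : 0 < b := one_pos.trans hb
  have hpos : ∀ i j, 0 < expBase b A i j := fun i j => Real.rpow_pos_of_pos hb0 _
  have hupos : ∀ i, 0 < b ^ u i := fun i => Real.rpow_pos_of_pos hb0 _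
  cases M with
  | principalEigenvector =>
    obtain ⟨rho, h⟩ := h
    have hv : (expBase b A).mulVec (fun i => b ^ u i) = rho • fun i => b ^ u i := by
      funext i
      simp only [Matrix.mulVec, dotProduct, expBase, Matrix.of_apply, Pi.smul_apply, smul_eq_mul]
      rw [← h i, Finset.sum_mul]
      refine Finset.sum_congr rfl fun j _ => ?_
      rw [← Real.rpow_add hb0, ← Real.rpow_add hb0]
      simp only [scoreMatrix, Matrix.sub_apply, Matrix.of_apply]
      ring_nf
    have hP := isPrincipalEigenvector_of_mulVec_eq_smul hpos hupos hv
    have huniq : ∀ w', IsPrincipalEigenvector (expBase b A) w' →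
        EqUpToScale (fun i => b ^ u i) w' := fun w' ⟨hw', _, hr, _⟩ =>
      eqUpToScale_of_mulVec_eq_smul hpos hupos hw' hv hr
    exact ⟨⟨_, hP, huniq, hσ.rpow hb⟩, ⟨_, hP, huniq, hσ.rpow hb⟩⟩
  | hodgeRank =>
    refine ⟨⟨u, isHodgeRankVector_of_sum_eq_zero hA h,
      fun w' hw' => IsHodgeRankVector.eqUpToShift hA h hw', hσ⟩, ?_⟩
    have hlb : 0 < Real.log b := Real.log_pos hb
    have hA' : IsAPCM (logMatrix (expBase b A)) := fun i j => by
      simp only [logMatrix, expBase, Matrix.of_apply, Real.log_rpow hb0]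
      rw [hA i j]; ring
    have h' : ∀ i, ∑ j, (logMatrix (expBase b A) -
        scoreMatrix fun i => Real.log (b ^ u i)) i j = 0 := fun i => by
      have : ∀ j, (logMatrix (expBase b A) - scoreMatrix fun i => Real.log (b ^ u i)) i j =
          Real.log b * (A - scoreMatrix u) i j := fun j => by
        simp only [logMatrix, expBase, scoreMatrix, Matrix.sub_apply, Matrix.of_apply,
          Real.log_rpow hb0]
        ring
      simp_rw [this, ← Finset.mul_sum]
      rw [h i, mul_zero]
    refine ⟨fun i => b ^ u i, ⟨hupos, isHodgeRankVector_of_sum_eq_zero hA' h'⟩, ?_, hσ.rpow hb⟩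
    rintro w' ⟨hw', hh'⟩
    obtain ⟨c, hc⟩ := IsHodgeRankVector.eqUpToShift hA' h' hh'
    refine EqUpToShift.eqUpToScale_rpow hb hw' ⟨c / Real.log b, fun i => ?_⟩
    have hci : Real.log (w' i) = c + Real.log (b ^ u i) := hc i
    change Real.logb b (w' i) = c / Real.log b + u i
    rw [← Real.log_div_log, hci, Real.log_rpow hb0]
    field_simp
  | tropicalEigenvector =>
    obtain ⟨lam, f, r, h1, h2, h3⟩ := h
    have hT := isMaxPlusEigenvector_of_tight h1 h2
    exact ⟨⟨u, hT, fun w' hw' => IsMaxPlusEigenvector.eqUpToShift h1 h2 h3 hw', hσ⟩,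
      ⟨_, hT.isMaxTimesEigenvector hb, fun w' hw' => EqUpToShift.eqUpToScale_rpow hb hw'.1
        (IsMaxPlusEigenvector.eqUpToShift h1 h2 h3 (hw'.isMaxPlusEigenvector hb)), hσ.rpow hb⟩⟩

/-! ### Arbitrary pairs of rankings -/

/-- A single matrix, for each number of items, on which any two of the three methods have score
vectors whose difference is strictly monotone in the index of the item. -/
theorem exists_balanced_strictMono_sub (k : ℕ) {b : ℝ} (hb : 1 < b) :
    ∃ (D : Matrix (Fin (k + 4)) (Fin (k + 4)) ℝ) (u : RankingMethod → Fin (k + 4) → ℝ),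
      IsAPCM D ∧ (∀ M : RankingMethod, M.Balanced b (D - scoreMatrix (u M))) ∧
      ∀ M₁ M₂, M₁ ≠ M₂ → StrictMono (u M₁ - u M₂) ∨ StrictAnti (u M₁ - u M₂) := by
  have hb0 : 0 < b := one_pos.trans hb
  have hlb : 0 < Real.log b := Real.log_pos hb
  obtain ⟨Y, rho, L, q, w, f, h⟩ := exists_isOpposed k
  set D : Matrix (Fin (k + 4)) (Fin (k + 4)) ℝ := Matrix.of fun i j => Real.logb b (Y i j) with hD
  set s : Fin (k + 4) → ℝ := fun i => (∑ j, D i j) / (k + 4) with hs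
  set m : Fin (k + 4) → ℝ := fun i => Real.logb b (w i) with hm
  have hskew : IsAPCM D := fun i j => by
    simp only [hD, Matrix.of_apply]
    rw [eq_inv_of_mul_eq_one_left (h.recip i j), Real.logb_inv]
  have hsum : ∑ i, ∑ j, D i j = 0 := by
    have h1 : ∑ i, ∑ j, D i j = -∑ i, ∑ j, D i j := by
      refine Finset.sum_comm.trans ?_
      rw [← Finset.sum_neg_distrib]
      refine Finset.sum_congr rfl fun i _ => ?_
      rw [← Finset.sum_neg_distrib]
      exact Finset.sum_congr rfl fun j _ => hskew j i
    linarith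
  have hs_anti : StrictAnti s := fun i j hij => by
    refine div_lt_div_of_pos_right ?_ (by positivity)
    simp only [hD, Matrix.of_apply, ← Real.log_div_log, ← Finset.sum_div]
    exact div_lt_div_of_pos_right (h.anti hij) hlb
  have hm_mono : StrictMono m := fun i j hij => Real.logb_lt_logb hb (h.w_pos i) (h.mono hij)
  have hentry : ∀ i j, (D - scoreMatrix m) i j = Real.logb b (Y i j * w j / w i) := fun i j => by
    rw [Real.logb_div (mul_pos (h.pos i j) (h.w_pos j)).ne' (h.w_pos i).ne',
      Real.logb_mul (h.pos i j).ne' (h.w_pos j).ne']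
    simp only [hD, hm, scoreMatrix, Matrix.sub_apply, Matrix.of_apply]
    ring
  refine ⟨D, fun M => match M with
    | .principalEigenvector => 0
    | .hodgeRank => s
    | .tropicalEigenvector => m, hskew, fun M => ?_, fun M₁ M₂ hM => ?_⟩
  · cases M with
    | principalEigenvector =>
      refine ⟨rho, fun i => ?_⟩
      rw [← h.row_sum i]
      refine Finset.sum_congr rfl fun j _ => ?_
      simp [hD, scoreMatrix, Real.rpow_logb hb0 hb.ne' (h.pos i j)]
    | hodgeRank =>
      intro i
      have h2 : ∑ j, s j = 0 := by
        simp only [hs]; rw [← Finset.sum_div, hsum, zero_div]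
      have h3 : (k + 4 : ℝ) * s i = ∑ j, D i j := by
        simp only [hs]; field_simp
      have h4 : ∑ j, (D - scoreMatrix s) i j = ∑ j, D i j - ((k + 4 : ℝ) * s i - ∑ j, s j) := by
        simp [scoreMatrix, Finset.sum_sub_distrib]
      change ∑ j, (D - scoreMatrix s) i j = 0
      rw [h4, h2, h3]; ring
    | tropicalEigenvector =>
      refine ⟨Real.logb b L, f, Fin.last (k + 3), fun i => ?_, fun i j hj => ?_, h.reach⟩
      · change (D - scoreMatrix m) i (f i) = _
        rw [hentry, h.tight i, mul_div_cancel_right₀ _ (h.w_pos i).ne']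
      · change (D - scoreMatrix m) i j < _
        have hw := h.w_pos i
        rw [hentry]
        refine Real.logb_lt_logb hb (div_pos (mul_pos (h.pos i j) (h.w_pos j)) hw) ?_
        rw [div_lt_iff₀ hw]
        exact h.slack i j hj
  · have aux : ∀ {i j : Fin (k + 4)}, i < j → s j < s i ∧ m i < m j := fun hij =>
      ⟨hs_anti hij, hm_mono hij⟩
    cases M₁ <;> cases M₂
    · exact absurd rfl hM
    · exact Or.inl fun i j hij => by
        have := aux hij
        simp only [Pi.sub_apply, Pi.zero_apply]; linarith
    · exact Or.inr fun i j hij => by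
        have := aux hij
        simp only [Pi.sub_apply, Pi.zero_apply]; linarith
    · exact Or.inr fun i j hij => by
        have := aux hij
        simp only [Pi.sub_apply, Pi.zero_apply]; linarith
    · exact absurd rfl hM
    · exact Or.inr fun i j hij => by
        have := aux hij
        simp only [Pi.sub_apply]; linarith
    · exact Or.inl fun i j hij => by
        have := aux hij
        simp only [Pi.sub_apply, Pi.zero_apply]; linarith
    · exact Or.inl fun i j hij => by
        have := aux hij
        simp only [Pi.sub_apply]; linarith
    · exact absurd rfl hM

theorem InducesRanking.exists_add_smul {n : ℕ} {x : Fin n → ℝ} {σ : Equiv.Perm (Fin n)}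
    (hx : InducesRanking x σ) (y : Fin n → ℝ) :
    ∃ ε : ℝ, 0 < ε ∧ InducesRanking (x + ε • y) σ := by
  have h : ∀ᶠ ε : ℝ in nhds 0, ∀ i j, i < j → (x + ε • y) (σ j) < (x + ε • y) (σ i) := by
    refine Filter.eventually_all.2 fun i => Filter.eventually_all.2 fun j => ?_
    by_cases hij : i < j
    · have hj : Continuous fun ε : ℝ => (x + ε • y) (σ j) := by
        simp only [Pi.add_apply, Pi.smul_apply, smul_eq_mul]; fun_prop
      have hi : Continuous fun ε : ℝ => (x + ε • y) (σ i) := by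
        simp only [Pi.add_apply, Pi.smul_apply, smul_eq_mul]; fun_prop
      refine (hj.continuousAt.eventually_lt hi.continuousAt ?_).mono fun _ h _ => h
      simpa using hx hij
    · exact Filter.Eventually.of_forall fun _ h => absurd h hij
  obtain ⟨ε, hε, hpos⟩ :=
    ((h.filter_mono nhdsWithin_le_nhds).and (self_mem_nhdsWithin (s := Set.Ioi (0 : ℝ)))).exists
  exact ⟨ε, hpos, fun i j hij => hε i j hij⟩

theorem theorem1 (n : ℕ) (hn : 4 ≤ n) (b : ℝ) (hb : 1 < b) (M₁ M₂ : RankingMethod)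
    (hM : M₁ ≠ M₂) (σ₁ σ₂ : Equiv.Perm (Fin n)) :
    ∃ A X : Matrix (Fin n) (Fin n) ℝ, IsAPCM A ∧ IsMPCM X ∧ X = expBase b A ∧
      M₁.Gives b A σ₁ ∧ M₂.Gives b A σ₂ ∧
      M₁.MulGives X σ₁ ∧ M₂.MulGives X σ₂ := by
  have hb0 : 0 < b := one_pos.trans hb
  obtain ⟨k, rfl⟩ := Nat.exists_eq_add_of_le' hn
  obtain ⟨D, u, hD, hbal, hmono⟩ := exists_balanced_strictMono_sub k hb
  -- Relabel the items so that the difference of the two score vectors induces `σ₁`.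
  obtain ⟨τ, hτ⟩ : ∃ τ : Equiv.Perm (Fin (k + 4)),
      InducesRanking ((u M₁ - u M₂) ∘ τ) σ₁ := by
    rcases hmono M₁ M₂ hM with h | h
    · refine ⟨σ₁.symm.trans Fin.revPerm, fun i j hij => h ?_⟩
      simpa using hij
    · refine ⟨σ₁.symm, fun i j hij => h ?_⟩
      simpa using hij
  -- Shift by a matrix of differences so that the second score vector becomes a small multiple of
  -- one that induces `σ₂`.
  let y : Fin (k + 4) → ℝ := fun i => -((σ₂.symm i : ℕ) : ℝ)
  have hy : InducesRanking y σ₂ := fun i j hij => by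
    simpa [y] using hij
  obtain ⟨ε, hε, h₁⟩ := hτ.exists_add_smul y
  have h₂ : InducesRanking (ε • y) σ₂ := fun i j hij => mul_lt_mul_of_pos_left (hy hij) hε
  set A := D.submatrix τ τ + scoreMatrix (ε • y - u M₂ ∘ τ) with hA
  have hsub : ∀ v : Fin (k + 4) → ℝ, scoreMatrix (v ∘ τ) = (scoreMatrix v).submatrix τ τ :=
    fun v => rfl
  have hskew : IsAPCM A := fun i j => by
    simp only [hA, Matrix.add_apply, Matrix.submatrix_apply, scoreMatrix, Matrix.of_apply]
    rw [hD (τ i) (τ j)]; ring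
  have hshift : ∀ M : RankingMethod,
      M.Balanced b (A - scoreMatrix ((u M - u M₂) ∘ τ + ε • y)) := by
    intro M
    have : A - scoreMatrix ((u M - u M₂) ∘ τ + ε • y) =
        (D - scoreMatrix (u M)).submatrix τ τ := by
      ext i j
      simp [hA, scoreMatrix]
      ring
    rw [this]
    exact (hbal M).submatrix τ
  have g₁ := (hshift M₁).gives hb hskew h₁
  have g₂ : M₂.Gives b A σ₂ ∧ M₂.MulGives (expBase b A) σ₂ := by
    refine (hshift M₂).gives hb hskew ?_
    simpa using h₂
  refine ⟨A, expBase b A, hskew, fun i j => ⟨Real.rpow_pos_of_pos hb0 _, ?_⟩, rfl,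
    g₁.1, g₂.1, g₁.2, g₂.2⟩
  simp only [expBase, Matrix.of_apply]
  rw [hskew i j, Real.rpow_neg hb0.le, one_div]
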